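/- Let $n$ and $r$ be positive integers, and let $\mathrm{GL}_n(\mathbb{C})$ act on $\mathfrak{gl}_n(\mathbb{C})$ by conjugation; the orbits are called adjoint orbits. Order them by the closure order: $\mathcal{O}\preceq\mathcal{O}'$ if and only if $\mathcal{O}\subseteq\overline{\mathcal{O}'}$ (Zariski closure). Let $$V^r=\{(x_{ij})\in\mathfrak{gl}_n(\mathbb{C})\mid x_{ij}=0\text{ if } i-j>r,\ \text{and } x_{ij}\neq 0\text{ if } i-j=r\}$$ be the set of matrices with zeros below, and nonzero entries on, the $r$th subdiagonal. For a positive integer $m$, write $m=kr+r'$ with integers $k\ge 0$ and $0\le r'<r$, and let $\lambda^{r,m}$ be the partition of $m$ with $r'$ parts equal to $k+1$ and $r-r'$ parts equal to $k$ (parts equal to $0$ are discarded). For a monic polynomial $q=\prod_{i=1}^s(x-a_i)^{m_i}\in\mathbb{C}[x]$ of degree $n$, with $a_1,\dots,a_s$ distinct and all $m_i>0$, let $\mathcal{O}^r_q$ be the adjoint orbit of matrices with characteristic polynomial $q$ whose Jordan blocks with eigenvalue $a_i$ have as sizes the parts of $\lambda^{r,m_i}$, for $i=1,\dots,s$. Then: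 1. An adjoint orbit in $\mathfrak{gl}_n(\mathbb{C})$ intersects $V^r$ if and only if its elements have at most $r$ Jordan blocks for each eigenvalue. 2. The minimal elements, with respect to $\preceq$, of the set of adjoint orbits that intersect $V^r$ are precisely the orbits $\mathcal{O}^r_q$, where $q$ runs over the monic polynomials of degree $n$. -/

import Mathlib

open Polynomial

/-- The adjoint orbits of `GL_n(ℂ)` in `gl_n(ℂ)`, i.e. the similarity classes of complex
`n × n` matrices; `GL_n(ℂ)` acts by `g • X = g X g⁻¹`. -/
abbrev AdjointOrbit (n : ℕ) : Type :=
  MulAction.orbitRel.Quotient (ConjAct (GL (Fin n) ℂ)) (Matrix (Fin n) (Fin n) ℂ)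

/-- The adjoint orbit of a matrix. -/
def adjointOrbitOf {n : ℕ} (X : Matrix (Fin n) (Fin n) ℂ) : AdjointOrbit n :=
  Quotient.mk'' X

/-- The Zariski closure of a set of matrices, inside the affine space `gl_n(ℂ)`. -/
def zariskiClosure {n : ℕ} (S : Set (Matrix (Fin n) (Fin n) ℂ)) :
    Set (Matrix (Fin n) (Fin n) ℂ) :=
  {X | ∀ p : MvPolynomial (Fin n × Fin n) ℂ,
    (∀ Y ∈ S, MvPolynomial.eval (fun ij => Y ij.1 ij.2) p = 0) →
      MvPolynomial.eval (fun ij => X ij.1 ij.2) p = 0}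

/-- The closure order on adjoint orbits: `O ≼ O'` iff `O` lies in the closure of `O'`. -/
def AdjointOrbit.ClosureLE {n : ℕ} (O O' : AdjointOrbit n) : Prop :=
  O.orbit ⊆ zariskiClosure O'.orbit

/-- The minimal elements, for the closure order, of a set of adjoint orbits. -/
def minimalOrbits {n : ℕ} (S : Set (AdjointOrbit n)) : Set (AdjointOrbit n) :=
  {O | O ∈ S ∧ ∀ O' ∈ S, O'.ClosureLE O → O' = O}

/-- The matrices with zeros below, and nonzero entries on, the `r`-th subdiagonal. -/
def subdiagonalSet (n r : ℕ) : Set (Matrix (Fin n) (Fin n) ℂ) :=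
  {X | ∀ i j : Fin n,
    ((j : ℕ) + r < (i : ℕ) → X i j = 0) ∧ ((i : ℕ) = (j : ℕ) + r → X i j ≠ 0)}

/-- The adjoint orbits that meet `subdiagonalSet n r`. -/
def orbitsMeeting (n r : ℕ) : Set (AdjointOrbit n) :=
  {O | (O.orbit ∩ subdiagonalSet n r).Nonempty}

/-- The Jordan block of size `k` with eigenvalue `a`. -/
def jordanBlock (a : ℂ) (k : ℕ) : Matrix (Fin k) (Fin k) ℂ :=
  Matrix.of fun i j => if i = j then a else if (i : ℕ) + 1 = (j : ℕ) then 1 else 0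

/-- The `j`-th part of a partition, the parts being listed in nonincreasing order. -/
def partAt {m : ℕ} (lam : Nat.Partition m) (j : Fin (lam.parts.sort (· ≥ ·)).length) : ℕ :=
  (lam.parts.sort (· ≥ ·)).get j

/-- A choice, for every `a`, of a partition of the multiplicity of `a` as a root of `q`.
When `a` is not a root of `q` there is only the empty partition of `0` to choose. -/
abbrev JordanData (q : ℂ[X]) : Type :=
  (a : ℂ) → Nat.Partition (q.rootMultiplicity a)

/-- The Jordan blocks prescribed by `L`: pairs of a root `a` of `q` and (the position of) a part
of the partition `L a`. -/
abbrev JordanBlockIndex {q : ℂ[X]} (L : JordanData q) : Type :=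
  (a : {a : ℂ // a ∈ q.roots.toFinset}) × Fin ((L a).parts.sort (· ≥ ·)).length

/-- The total size of the Jordan blocks prescribed by `L` is the degree of `q`. -/
theorem card_jordanIndex {q : ℂ[X]} (L : JordanData q) :
    Fintype.card ((b : JordanBlockIndex L) × Fin (partAt (L b.1) b.2)) = q.natDegree := by
  have hpart : ∀ {m : ℕ} (lam : Nat.Partition m), ∑ j, partAt lam j = m := by
    intro m lam
    have h : ∑ j, partAt lam j = (lam.parts.sort (· ≥ ·)).sum := by
      rw [← List.sum_ofFn]
      congr 1
      exact List.ofFn_get _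
    rw [h, ← Multiset.sum_coe, Multiset.sort_eq, lam.parts_sum]
  rw [Fintype.card_sigma]
  simp only [Fintype.card_fin]
  rw [Fintype.sum_sigma]
  simp only [hpart]
  rw [Finset.sum_coe_sort q.roots.toFinset (fun a => q.rootMultiplicity a)]
  simp only [← Polynomial.count_roots]
  rw [Multiset.toFinset_sum_count_eq]
  exact (IsAlgClosed.splits q).natDegree_eq_card_roots.symm

/-- The monic complex polynomials of degree `n`. -/
abbrev MonicPoly (n : ℕ) : Type := {q : ℂ[X] // q.Monic ∧ q.natDegree = n}

/-- The block diagonal matrix in Jordan form with characteristic polynomial `q` whose Jordan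
blocks with eigenvalue `a` have the parts of `L a` as their sizes. The rows and columns are
numbered by `Fin n` in an arbitrary way, which does not affect the orbit. -/
noncomputable def jordanMatrix {n : ℕ} (q : MonicPoly n) (L : JordanData q.1) :
    Matrix (Fin n) (Fin n) ℂ :=
  let e := Fintype.equivFinOfCardEq ((card_jordanIndex L).trans q.2.2)
  Matrix.reindex e e
    (Matrix.blockDiagonal' fun b : JordanBlockIndex L => jordanBlock b.1.1 (partAt (L b.1) b.2))

/-- The adjoint orbit with characteristic polynomial `q` and Jordan block sizes given by `L`. -/
noncomputable def jordanOrbit {n : ℕ} (q : MonicPoly n) (L : JordanData q.1) : AdjointOrbit n :=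
  adjointOrbitOf (jordanMatrix q L)

/-- The orbits with characteristic polynomial `q` that have at most `r` Jordan blocks for each
eigenvalue. -/
def filterOfPoly {n : ℕ} (r : ℕ) (q : MonicPoly n) : Set (AdjointOrbit n) :=
  {O | ∃ L : JordanData q.1, (∀ a, (L a).parts.card ≤ r) ∧ O = jordanOrbit q L}

/-- The orbits with at most `r` Jordan blocks for each eigenvalue. -/
def orbitFilter (n r : ℕ) : Set (AdjointOrbit n) :=
  ⋃ q : MonicPoly n, filterOfPoly r q

/-- For `r > 0` and `m = k r + r'` with `0 ≤ r' < r`, the partition of `m` with `r'` parts equal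
to `k + 1` and `r - r'` parts equal to `k` (where parts equal to `0` are discarded). -/
def balancedPartition (r m : ℕ) : Nat.Partition m :=
  Nat.Partition.ofSums m
    (Multiset.replicate (m % r) (m / r + 1) + Multiset.replicate (r - m % r) (m / r)) (by
      rcases Nat.eq_zero_or_pos r with rfl | hr
      · simp
      · obtain ⟨c, hc⟩ := Nat.exists_eq_add_of_le (Nat.mod_lt m hr).le
        have h1 : r - m % r = c := by omega
        have h2 := Nat.div_add_mod m r
        simp only [Multiset.sum_add, Multiset.sum_replicate, smul_eq_mul, h1]
        calc m % r * (m / r + 1) + c * (m / r) = (m % r + c) * (m / r) + m % r := by ring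
          _ = m := by rw [← hc]; exact h2)

/-- The orbit with characteristic polynomial `q` such that, for each root `a` of `q` with
multiplicity `m`, the sizes of the Jordan blocks with eigenvalue `a` form
`balancedPartition r m`. -/
noncomputable def balancedOrbit {n : ℕ} (r : ℕ) (q : MonicPoly n) : AdjointOrbit n :=
  jordanOrbit q fun a => balancedPartition r (q.1.rootMultiplicity a)

/-!
The rank of `(X - a) ^ k` is lower semicontinuous in `X`, and it is at least `n - r k` when `X` has
zeros below and nonzero entries on the `r`-th subdiagonal, because the power is of the same shape
with `r k` in place of `r`. Hence `dim ker (X - a) ^ k ≤ r k` on the orbits meeting `V ^ r`, which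
for `k = 1` bounds the number of Jordan blocks; since `dim ker (X - a) ^ k ≤ m` for an eigenvalue of
multiplicity `m` too, and equality `min m (r k)` holds for the balanced partition, the balanced
orbits are minimal.

Every orbit with at most `r` blocks per eigenvalue lies above a balanced one: as long as two
blocks for the same eigenvalue differ by more than one in size, moving a box from the larger to the
smaller one gives a smaller orbit. A balanced orbit contains a matrix with entries only on the
diagonal and the `r`-th subdiagonal, so it meets `V ^ r`. Finally, meeting `V ^ r` is inherited by
larger orbits: it amounts to the nonvanishing of the determinant of a Krylov matrix of some
conjugate, an open condition.
-/

open Module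

section JordanChain

variable {R M : Type*} [CommRing R] [AddCommGroup M] [Module R M]

/-- A Jordan chain of length `l` for the eigenvalue `a` of `f`: the vectors `v 1, …, v l`, of which
`v 1` is an eigenvector. The index `0` carries the zero vector, so that the relation
`f (v (j + 1)) = a • v (j + 1) + v j` also covers the eigenvector; the values beyond `l` are
irrelevant. -/
structure IsJordanChain (f : Module.End R M) (a : R) (l : ℕ) (v : ℕ → M) : Prop where
  zero : v 0 = 0
  apply_succ : ∀ j < l, f (v (j + 1)) = a • v (j + 1) + v j

namespace IsJordanChain

variable {f : Module.End R M} {a : R} {l : ℕ} {v : ℕ → M}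

theorem sub_apply_succ (h : IsJordanChain f a l v) {j : ℕ} (hj : j < l) :
    (f - a • 1) (v (j + 1)) = v j := by
  simp [h.apply_succ j hj]

theorem sub_pow_apply_add (h : IsJordanChain f a l v) (j k : ℕ) (hjk : j + k ≤ l) :
    ((f - a • 1) ^ k) (v (j + k)) = v j := by
  induction k with
  | zero => rfl
  | succ k ih =>
    rw [pow_succ, Module.End.mul_apply, ← add_assoc, h.sub_apply_succ (by omega), ih (by omega)]

theorem mem_genEigenspace (h : IsJordanChain f a l v) {j k : ℕ} (hj : j ≤ l) (hk : j ≤ k) :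
    v j ∈ f.genEigenspace a k := by
  refine (f.genEigenspace a).mono (Nat.cast_le.2 hk) ?_
  rw [Module.End.mem_genEigenspace_nat, LinearMap.mem_ker]
  simpa [h.zero] using h.sub_pow_apply_add 0 j (by omega)

theorem of_sub_pow_apply_eq_zero {e : ℕ} {x : M} (hx : ((f - a • 1) ^ e) x = 0) :
    IsJordanChain f a e fun j => ((f - a • 1) ^ (e - j)) x where
  zero := hx
  apply_succ j hj := by
    have hpow : f = (f - a • 1) + a • 1 := by abel
    have hsub : e - j = (e - (j + 1)) + 1 := by omega
    rw [hsub, pow_succ' _ (e - (j + 1)), Module.End.mul_apply]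
    nth_rewrite 1 [hpow]
    rw [LinearMap.add_apply, LinearMap.smul_apply, Module.End.one_apply, add_comm]

end IsJordanChain

theorem IsJordanChain.mem_range_sub_pow {K V : Type*} [Field K] [AddCommGroup V] [Module K V]
    {f : Module.End K V} {a b : K} {l : ℕ} {v : ℕ → V} (h : IsJordanChain f a l v)
    (hab : a ≠ b) (k : ℕ) : ∀ j ≤ l, v j ∈ LinearMap.range ((f - b • 1) ^ k) := by
  induction k with
  | zero => exact fun j _ => ⟨v j, rfl⟩
  | succ k ihk =>
    intro j
    induction j with
    | zero => exact fun _ => h.zero ▸ Submodule.zero_mem _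
    | succ j ihj =>
      intro hj
      obtain ⟨y, hy⟩ := ihk (j + 1) hj
      have key : v (j + 1) = (a - b)⁻¹ • ((f - b • 1) (v (j + 1)) - v j) := by
        have : (f - b • 1) (v (j + 1)) - v j = (a - b) • v (j + 1) := by
          simp only [LinearMap.sub_apply, h.apply_succ j hj, LinearMap.smul_apply,
            Module.End.one_apply]
          module
        rw [this, inv_smul_smul₀ (sub_ne_zero.2 hab)]
      rw [key]
      refine Submodule.smul_mem _ _ (Submodule.sub_mem _ ⟨y, ?_⟩ (ihj (by omega)))
      rw [pow_succ', Module.End.mul_apply, hy]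

end JordanChain

section JordanBasis

variable {K V ι κ : Type*} [Field K] [AddCommGroup V] [Module K V]

theorem card_le_finrank_of_basis_mem [FiniteDimensional K V] (b : Basis ι K V)
    (S : Finset ι) (W : Submodule K V) (hS : ∀ i ∈ S, b i ∈ W) : S.card ≤ finrank K W := by
  have hW (i : S) : b i ∈ W := hS i i.2
  have hli : LinearIndependent K fun i : S => (⟨b i, hW i⟩ : W) :=
    .of_comp W.subtype (b.linearIndependent.comp _ Subtype.val_injective)
  simpa using hli.fintype_card_le_finrank

variable [Fintype ι] [Fintype κ]

/-- A Jordan basis of `f`: the disjoint union of Jordan chains `v i 1, …, v i (s i)` for the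
eigenvalues `d i`. Empty blocks, `s i = 0`, are allowed. -/
structure IsJordanBasis (f : End K V) (d : ι → K) (s : ι → ℕ) (v : ι → ℕ → V) : Prop where
  chain : ∀ i, IsJordanChain f (d i) (s i) (v i)
  span_eq_top : Submodule.span K (Set.range fun x : (i : ι) × Fin (s i) => v x.1 (x.2 + 1)) = ⊤
  sum_eq_finrank : ∑ i, s i = finrank K V

theorem card_filter_sigma {s : ι → ℕ} (P : ι → ℕ → Prop) [∀ i, DecidablePred (P i)] :
    (Finset.univ.filter fun x : (i : ι) × Fin (s i) => P x.1 x.2).card =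
      ∑ i, (Finset.univ.filter fun j : Fin (s i) => P i j).card := by
  rw [← Finset.card_sigma]
  congr 1
  ext x
  simp

namespace IsJordanBasis

variable {f : End K V} {d : ι → K} {s : ι → ℕ} {v : ι → ℕ → V}

/-- The vectors of a Jordan basis, as a basis in the sense of linear algebra. -/
noncomputable def basis (h : IsJordanBasis f d s v) : Basis ((i : ι) × Fin (s i)) K V :=
  basisOfTopLeSpanOfCardEqFinrank (fun x => v x.1 (x.2 + 1)) h.span_eq_top.ge (by
    simpa using h.sum_eq_finrank)

theorem basis_apply (h : IsJordanBasis f d s v) (x : (i : ι) × Fin (s i)) :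
    h.basis x = v x.1 (x.2 + 1) := by
  simp [basis]

theorem comp_injective (h : IsJordanBasis f d s v) {e : κ → ι} (he : e.Injective)
    (hs : ∀ i ∉ Set.range e, s i = 0) : IsJordanBasis f (d ∘ e) (s ∘ e) (v ∘ e) where
  chain i := h.chain (e i)
  span_eq_top := by
    refine top_le_iff.1 (h.span_eq_top.ge.trans (Submodule.span_mono ?_))
    rintro _ ⟨⟨i, j⟩, rfl⟩
    obtain ⟨i, rfl⟩ := not_imp_comm.1 (hs i) (by have := j.2; omega)
    exact ⟨⟨i, j⟩, rfl⟩
  sum_eq_finrank := by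
    rw [← h.sum_eq_finrank]
    exact Fintype.sum_of_injective e he _ _ hs fun _ => rfl

theorem finrank_genEigenspace [DecidableEq K] [FiniteDimensional K V] (h : IsJordanBasis f d s v)
    (a : K) (k : ℕ) :
    finrank K (f.genEigenspace a k) = ∑ i with d i = a, min (s i) k := by
  have hker : ∑ i with d i = a, min (s i) k ≤ finrank K (f.genEigenspace a k) := by
    refine le_of_eq_of_le ?_ (card_le_finrank_of_basis_mem h.basis
      (Finset.univ.filter fun x => d x.1 = a ∧ (x.2 : ℕ) < k) _ fun x hx => ?_)
    · rw [card_filter_sigma fun i j => d i = a ∧ j < k, Finset.sum_filter]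
      refine Finset.sum_congr rfl fun i _ => ?_
      by_cases hi : d i = a <;> simp [hi, Fin.card_filter_val_lt]
    · obtain ⟨rfl, hk⟩ := (Finset.mem_filter.1 hx).2
      rw [h.basis_apply]
      exact (h.chain x.1).mem_genEigenspace x.2.2 hk
  have hrange : ∑ i, (if d i = a then s i - k else s i) ≤
      finrank K (LinearMap.range ((f - a • 1) ^ k)) := by
    refine le_of_eq_of_le ?_ (card_le_finrank_of_basis_mem h.basis
      (Finset.univ.filter fun x => d x.1 = a → (x.2 : ℕ) < s x.1 - k) _ fun x hx => ?_)
    · rw [card_filter_sigma fun i j => d i = a → j < s i - k]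
      refine Finset.sum_congr rfl fun i _ => ?_
      by_cases hi : d i = a <;> simp [hi, Fin.card_filter_val_lt]
    · rw [h.basis_apply]
      by_cases hx' : d x.1 = a
      · have hlt := (Finset.mem_filter.1 hx).2 hx'
        subst hx'
        exact ⟨_, (h.chain x.1).sub_pow_apply_add _ _ (by omega)⟩
      · exact (h.chain x.1).mem_range_sub_pow hx' k _ x.2.2
  have hrank := LinearMap.finrank_range_add_finrank_ker ((f - a • 1) ^ k)
  rw [← Module.End.genEigenspace_nat, ← h.sum_eq_finrank] at hrank
  have hsum : ∑ i, s i =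
      ∑ i with d i = a, min (s i) k + ∑ i, (if d i = a then s i - k else s i) := by
    rw [Finset.sum_filter, ← Finset.sum_add_distrib]
    refine Finset.sum_congr rfl fun i _ => ?_
    split_ifs <;> omega
  omega

end IsJordanBasis

/-- The candidate Jordan chains whose vectors are listed by `b`, in the indexing convention of
`IsJordanChain`. -/
def chainsOfFamily {s : ι → ℕ} (b : (i : ι) × Fin (s i) → V) (i : ι) : ℕ → V
  | 0 => 0
  | j + 1 => if h : j < s i then b ⟨i, j, h⟩ else 0

theorem isJordanBasis_chainsOfFamily {f : End K V} {d : ι → K} {s : ι → ℕ}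
    (b : Basis ((i : ι) × Fin (s i)) K V)
    (hf : ∀ x, f (b x) = d x.1 • b x + chainsOfFamily b x.1 x.2) :
    IsJordanBasis f d s (chainsOfFamily b) where
  chain i :=
    { zero := rfl
      apply_succ := fun j hj => by simpa [chainsOfFamily, hj] using hf ⟨i, j, hj⟩ }
  span_eq_top := by simp [chainsOfFamily, b.span_eq]
  sum_eq_finrank := by simp [finrank_eq_card_basis b]

theorem exists_isJordanBasis_of_sum_eq [FiniteDimensional K V] (d : ι → K) (s : ι → ℕ)
    (hs : ∑ i, s i = finrank K V) :
    ∃ (f : End K V) (v : ι → ℕ → V), IsJordanBasis f d s v := by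
  have hcard : Fintype.card ((i : ι) × Fin (s i)) = finrank K V := by simpa using hs
  let b := (finBasis K V).reindex (Fintype.equivFinOfCardEq hcard).symm
  exact ⟨b.constr K fun x => d x.1 • b x + chainsOfFamily b x.1 x.2, _,
    isJordanBasis_chainsOfFamily b fun x => b.constr_basis K _ x⟩

end JordanBasis

section Existence

universe u w

variable {K : Type u} {V : Type w} [Field K] [AddCommGroup V] [Module K V]

open DirectSum in
theorem exists_primary_cyclic_decomposition [FiniteDimensional K V] (f : End K V) :
    ∃ (ι : Type u) (_ : Fintype ι) (p : ι → K[X]) (e : ι → ℕ) (x : ι → V),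
      (∀ i, Irreducible (p i)) ∧ (∀ i, aeval f (p i ^ e i) (x i) = 0) ∧
        (∀ y, ∃ q : ι → K[X], y = ∑ i, aeval f (q i) (x i)) ∧
          ∑ i, (p i ^ e i).natDegree = finrank K V := by
  classical
  obtain ⟨ι, _, p, hp, e, ⟨φ⟩⟩ :=
    equiv_directSum_of_isTorsion (AEval.isTorsion_of_finiteDimensional K V f)
  let o := (AEval.of K V f).symm
  let x (i : ι) : V := o (φ.symm (lof K[X] ι (fun i => K[X] ⧸ K[X] ∙ p i ^ e i) i
    (Submodule.Quotient.mk 1)))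
  have hx (i : ι) (q : K[X]) :
      aeval f q (x i) = o (φ.symm (lof K[X] ι _ i (Submodule.Quotient.mk q))) := by
    have hq : (Submodule.Quotient.mk q : K[X] ⧸ K[X] ∙ p i ^ e i) =
        q • Submodule.Quotient.mk 1 := by
      rw [← Submodule.Quotient.mk_smul, smul_eq_mul, mul_one]
    rw [hq, map_smul, map_smul]
    exact (AEval.of_symm_smul f q _).symm
  refine ⟨ι, inferInstance, p, e, x, hp, fun i => ?_, fun y => ?_, ?_⟩
  · rw [hx, (Submodule.Quotient.mk_eq_zero _).2 (Submodule.mem_span_singleton_self _), map_zero,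
      map_zero, map_zero]
  · choose q hq using fun i => Submodule.Quotient.mk_surjective _ (φ (o.symm y) i)
    refine ⟨q, ?_⟩
    simp only [hx, hq, ← map_sum, lof_eq_of, sum_univ_of, LinearEquiv.symm_apply_apply,
      LinearEquiv.apply_symm_apply]
  · have hfinite (i : ι) : Module.Finite K (K[X] ⧸ K[X] ∙ p i ^ e i) :=
      PowerBasis.finite (AdjoinRoot.powerBasis (pow_ne_zero (e i) (hp i).ne_zero))
    rw [(AEval.of K V f).finrank_eq, (φ.restrictScalars K).finrank_eq, finrank_directSum]
    exact Finset.sum_congr rfl fun i _ => finrank_quotient_span_eq_natDegree.symm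

theorem aeval_apply_mem_span_of_sub_pow_apply_eq_zero {f : End K V} {a : K} {e : ℕ} {x : V}
    (hx : ((f - a • 1) ^ e) x = 0) (q : K[X]) :
    aeval f q x ∈ Submodule.span K (Set.range fun m : Fin e => ((f - a • 1) ^ (m : ℕ)) x) := by
  have haeval : aeval f (X - C a) = f - a • 1 := by simp [Algebra.algebraMap_eq_smul_one]
  rw [← sum_taylor_eq q a, Polynomial.sum, map_sum, LinearMap.sum_apply]
  refine Submodule.sum_mem _ fun m _ => ?_
  rw [← smul_eq_C_mul, map_smul, map_pow, haeval, LinearMap.smul_apply]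
  refine Submodule.smul_mem _ _ ?_
  obtain hm | hm := lt_or_ge m e
  · exact Submodule.subset_span ⟨⟨m, hm⟩, rfl⟩
  · obtain ⟨l, rfl⟩ := Nat.exists_eq_add_of_le' hm
    rw [pow_add, Module.End.mul_apply, hx, map_zero]
    exact Submodule.zero_mem _

theorem exists_isJordanBasis [IsAlgClosed K] [FiniteDimensional K V] (f : End K V) :
    ∃ (ι : Type u) (_ : Fintype ι) (d : ι → K) (s : ι → ℕ) (v : ι → ℕ → V),
      IsJordanBasis f d s v := by
  obtain ⟨ι, _, p, e, x, hp, hx, hspan, hsum⟩ := exists_primary_cyclic_decomposition f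
  choose a ha using fun i => IsAlgClosed.exists_root (p i) (hp i).degree_pos.ne'
  have hpa (i : ι) : Associated (X - C (a i)) (p i) :=
    (irreducible_X_sub_C (a i)).associated_of_dvd (hp i) (dvd_iff_isRoot.2 (ha i))
  have hx' (i : ι) : ((f - a i • 1) ^ e i) (x i) = 0 := by
    obtain ⟨c, hc⟩ := pow_dvd_pow_of_dvd (hpa i).symm.dvd (e i)
    have h := LinearMap.congr_fun (congrArg (aeval f) hc) (x i)
    rw [mul_comm, map_mul, Module.End.mul_apply, hx, map_zero] at h
    simpa [Algebra.algebraMap_eq_smul_one] using h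
  refine ⟨ι, inferInstance, a, e, fun i j => ((f - a i • 1) ^ (e i - j)) (x i),
    fun i => .of_sub_pow_apply_eq_zero (hx' i), ?_, ?_⟩
  · rw [eq_top_iff]
    rintro y -
    obtain ⟨q, rfl⟩ := hspan y
    refine Submodule.sum_mem _ fun i _ => Submodule.span_mono ?_
      (aeval_apply_mem_span_of_sub_pow_apply_eq_zero (hx' i) (q i))
    rintro _ ⟨m, rfl⟩
    refine ⟨⟨i, m.rev⟩, ?_⟩
    simp only [Fin.val_rev]
    congr 2
    omega
  · rw [← hsum]
    refine Finset.sum_congr rfl fun i _ => ?_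
    rw [← natDegree_eq_of_degree_eq (degree_eq_degree_of_associated ((hpa i).pow_pow (n := e i))),
      natDegree_pow, natDegree_X_sub_C, mul_one]

end Existence

section Uniqueness

variable {K V W ι κ : Type*} [Field K] [AddCommGroup V] [Module K V] [AddCommGroup W] [Module K W]
  [Fintype ι] [Fintype κ] {f : End K V} {g : End K W}

theorem IsJordanBasis.exists_linearEquiv {d : ι → K} {s : ι → ℕ} {v : ι → ℕ → V} {w : ι → ℕ → W}
    (hf : IsJordanBasis f d s v) (hg : IsJordanBasis g d s w) :
    ∃ φ : V ≃ₗ[K] W, φ.conj f = g := by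
  let φ := hf.basis.equiv hg.basis (Equiv.refl _)
  have hφ (i : ι) (j : ℕ) (hj : j ≤ s i) : φ (v i j) = w i j := by
    cases j with
    | zero => rw [(hf.chain i).zero, (hg.chain i).zero, map_zero]
    | succ j =>
      have h := hf.basis.equiv_apply ⟨i, j, hj⟩ hg.basis (Equiv.refl _)
      rwa [hf.basis_apply, Equiv.refl_apply, hg.basis_apply] at h
  refine ⟨φ, hg.basis.ext fun ⟨i, j⟩ => ?_⟩
  simp only [LinearEquiv.conj_apply_apply, hg.basis_apply]
  rw [(hg.chain i).apply_succ j j.2, ← hφ _ _ j.2, ← hφ _ _ j.2.le, LinearEquiv.symm_apply_apply,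
    (hf.chain i).apply_succ j j.2, map_add, map_smul]

theorem finrank_genEigenspace_conj (φ : V ≃ₗ[K] W) (f : End K V) (a : K) (k : ℕ) :
    finrank K ((φ.conj f).genEigenspace a k) = finrank K (f.genEigenspace a k) := by
  have hpow : (φ.conj f - a • 1) ^ k = φ.conj ((f - a • 1) ^ k) := by
    have hsub : φ.conj f - a • 1 = φ.conj (f - a • 1) := by
      rw [map_sub, map_smul, Module.End.one_eq_id, Module.End.one_eq_id, LinearEquiv.conj_id]
    rw [hsub]
    exact (map_pow φ.conjRingEquiv (f - a • 1) k).symm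
  have hker : LinearMap.ker (φ.conj ((f - a • 1) ^ k)) =
      (LinearMap.ker ((f - a • 1) ^ k)).map φ.toLinearMap := by
    rw [LinearEquiv.conj_apply, LinearMap.ker_comp, LinearEquiv.ker_comp,
      Submodule.map_equiv_eq_comap_symm]
  rw [Module.End.genEigenspace_nat, Module.End.genEigenspace_nat, hpow, hker]
  exact φ.finrank_map_eq _

variable [FiniteDimensional K V] [FiniteDimensional K W]

theorem IsJordanBasis.card_blocks_add [DecidableEq K] {d : ι → K} {s : ι → ℕ} {v : ι → ℕ → V}
    (h : IsJordanBasis f d s v) (a : K) (k : ℕ) :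
    Fintype.card {i // (d i, s i) = (a, k + 1)} +
        (finrank K (f.genEigenspace a k) + finrank K (f.genEigenspace a (k + 2 : ℕ))) =
      2 * finrank K (f.genEigenspace a (k + 1 : ℕ)) := by
  simp only [h.finrank_genEigenspace, Prod.mk.injEq, Fintype.card_subtype, ← Finset.filter_filter,
    Finset.card_filter _ (Finset.filter _ _)]
  rw [← Finset.sum_add_distrib, ← Finset.sum_add_distrib, Finset.mul_sum]
  refine Finset.sum_congr rfl fun i _ => ?_
  split_ifs <;> omega

theorem IsJordanBasis.exists_equiv {d : ι → K} {s : ι → ℕ} {v : ι → ℕ → V} {d' : κ → K}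
    {s' : κ → ℕ} {w : κ → ℕ → W} (hf : IsJordanBasis f d s v) (hg : IsJordanBasis g d' s' w)
    (hs : ∀ i, s i ≠ 0) (hs' : ∀ i, s' i ≠ 0)
    (hfg : ∀ (a : K) (k : ℕ), finrank K (f.genEigenspace a k) = finrank K (g.genEigenspace a k)) :
    ∃ e : ι ≃ κ, d' ∘ e = d ∧ s' ∘ e = s := by
  classical
  have hfiber (c : K × ℕ) : Nonempty ({i // (d i, s i) = c} ≃ {i // (d' i, s' i) = c}) := by
    rw [← Fintype.card_eq]
    obtain ⟨a, _ | k⟩ := c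
    · simp [hs, hs']
    · have hf' := hf.card_blocks_add a k
      have hg' := hg.card_blocks_add a k
      rw [hfg, hfg, hfg] at hf'
      omega
  let e := Equiv.ofFiberEquiv fun c => (hfiber c).some
  have he (i : ι) : (d' (e i), s' (e i)) = (d i, s i) :=
    Equiv.ofFiberEquiv_map (f := fun i => (d i, s i)) (g := fun i => (d' i, s' i)) _ i
  exact ⟨e, funext fun i => (Prod.ext_iff.1 (he i)).1, funext fun i => (Prod.ext_iff.1 (he i)).2⟩

theorem exists_conj_eq_iff [IsAlgClosed K] :
    (∃ φ : V ≃ₗ[K] W, φ.conj f = g) ↔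
      ∀ (a : K) (k : ℕ), finrank K (f.genEigenspace a k) = finrank K (g.genEigenspace a k) := by
  classical
  constructor
  · rintro ⟨φ, rfl⟩ a k
    exact (finrank_genEigenspace_conj φ f a k).symm
  · intro hfg
    obtain ⟨ι, _, d, s, v, hf⟩ := exists_isJordanBasis f
    obtain ⟨κ, _, d', s', w, hg⟩ := exists_isJordanBasis g
    have hf₀ := hf.comp_injective (e := ((↑) : {i // s i ≠ 0} → ι)) Subtype.val_injective (by simp)
    have hg₀ := hg.comp_injective (e := ((↑) : {i // s' i ≠ 0} → κ)) Subtype.val_injective (by simp)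
    obtain ⟨e, hd, hs⟩ := hf₀.exists_equiv hg₀ (fun i => i.2) (fun i => i.2) hfg
    have hg₁ := hg₀.comp_injective e.injective (by simp)
    rw [hd, hs] at hg₁
    exact hf₀.exists_linearEquiv hg₁

end Uniqueness

section Degeneration

variable {K V ι : Type*} [Field K] [AddCommGroup V] [Module K V]

/-- The Jordan chains of the perturbation `f + c • E`, where `v` are Jordan chains of `f` and `E`
maps the eigenvector `v i₁ 1` to the eigenvector `v i₂ 1` and kills all other vectors: the vector
`c • v i₂ 1` is put in front of the chain `v i₁`, and `v i₂` loses its eigenvector. -/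
def exchangedChains [DecidableEq ι] (v : ι → ℕ → V) (i₁ i₂ : ι) (c : K) (i : ι) : ℕ → V
  | 0 => 0
  | j + 1 =>
    if i = i₁ then if j = 0 then c • v i₂ 1 else v i₁ j
    else if i = i₂ then c • v i₂ (j + 2) - v i₁ (j + 1)
    else v i (j + 1)

namespace IsJordanBasis

variable [Fintype ι] [DecidableEq ι] {f g : End K V} {d : ι → K} {t : ι → ℕ} {v : ι → ℕ → V}
  {i₁ i₂ : ι} {c : K}

theorem isJordanChain_exchangedChains (h : IsJordanBasis f d (t + Pi.single i₂ 1) v)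
    (hi : i₁ ≠ i₂) (hd : d i₁ = d i₂) (ht : t i₂ < t i₁)
    (hg : ∀ i, ∀ j < (t + Pi.single i₂ 1 : ι → ℕ) i,
      g (v i (j + 1)) = f (v i (j + 1)) + if i = i₁ ∧ j = 0 then c • v i₂ 1 else 0) (i : ι) :
    IsJordanChain g (d i) ((t + Pi.single i₁ 1 : ι → ℕ) i) (exchangedChains v i₁ i₂ c i) where
  zero := rfl
  apply_succ j hj := by
    have hgv (i : ι) (j : ℕ) (hj : j < (t + Pi.single i₂ 1 : ι → ℕ) i) : g (v i (j + 1)) =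
        d i • v i (j + 1) + v i j + if i = i₁ ∧ j = 0 then c • v i₂ 1 else 0 := by
      rw [hg i j hj, (h.chain i).apply_succ j hj]
    have h₁ (j : ℕ) (hj : j < t i₁) := hgv i₁ j (by simp [hi, hj])
    have h₂ (j : ℕ) (hj : j ≤ t i₂) : g (v i₂ (j + 1)) = d i₂ • v i₂ (j + 1) + v i₂ j := by
      simpa [hi.symm] using hgv i₂ j (by simpa using Nat.lt_succ_of_le hj)
    obtain rfl | hi₁ := eq_or_ne i i₁
    · simp only [Pi.add_apply, Pi.single_eq_same] at hj
      match j with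
      | 0 => simp [exchangedChains, h₂, hd, smul_comm c (d i₂), (h.chain i₂).zero]
      | 1 => simp [exchangedChains, h₁ 0 (by omega), (h.chain i).zero]
      | j + 2 => simp [exchangedChains, h₁ (j + 1) (by omega)]
    obtain rfl | hi₂ := eq_or_ne i i₂
    · simp only [Pi.add_apply, Pi.single_eq_of_ne hi₁, add_zero] at hj
      match j with
      | 0 =>
        simp only [exchangedChains, hi₁, ↓reduceIte, map_sub, map_smul, h₂ 1 hj, h₁ 0 (by omega),
          (h.chain i₁).zero, hd, and_self]
        module
      | j + 1 =>
        simp only [exchangedChains, hi₁, ↓reduceIte, map_sub, map_smul, h₂ (j + 2) hj,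
          h₁ (j + 1) (by omega), hd, Nat.succ_ne_zero, and_false]
        module
    · simp only [Pi.add_apply, Pi.single_eq_of_ne hi₁, add_zero] at hj
      have hgi := hgv i j (by simp [hi₂, hj])
      cases j with
      | zero => simp [exchangedChains, hi₁, hi₂, hgi, (h.chain i).zero]
      | succ j => simp [exchangedChains, hi₁, hi₂, hgi]

theorem span_exchangedChains (h : IsJordanBasis f d (t + Pi.single i₂ 1) v) (hi : i₁ ≠ i₂)
    (ht : t i₂ < t i₁) (hc : c ≠ 0) :
    Submodule.span K (Set.range fun x : (i : ι) × Fin ((t + Pi.single i₁ 1 : ι → ℕ) i) =>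
      exchangedChains v i₁ i₂ c x.1 (x.2 + 1)) = ⊤ := by
  set S := Submodule.span K (Set.range fun x : (i : ι) × Fin ((t + Pi.single i₁ 1 : ι → ℕ) i) =>
    exchangedChains v i₁ i₂ c x.1 (x.2 + 1)) with hS
  have hmem (i : ι) (j : ℕ) (hj : j < (t + Pi.single i₁ 1 : ι → ℕ) i) :
      exchangedChains v i₁ i₂ c i (j + 1) ∈ S :=
    Submodule.subset_span ⟨⟨i, j, hj⟩, rfl⟩
  have h₁ (j : ℕ) (hj : j < t i₁) : v i₁ (j + 1) ∈ S := by
    simpa [exchangedChains] using hmem i₁ (j + 1) (by simp [hj])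
  refine top_le_iff.1 (h.span_eq_top.ge.trans (Submodule.span_le.2 ?_))
  rintro _ ⟨⟨i, j, hj⟩, rfl⟩
  simp only [SetLike.mem_coe]
  obtain rfl | hi₁ := eq_or_ne i i₁
  · exact h₁ j (by simpa [hi] using hj)
  obtain rfl | hi₂ := eq_or_ne i i₂
  · simp only [Pi.add_apply, Pi.single_eq_same] at hj
    rw [← S.smul_mem_iff hc]
    cases j with
    | zero => simpa [exchangedChains] using hmem i₁ 0 (by simp)
    | succ j =>
      have hj' := hmem i j (by simpa [hi₁] using hj)
      simp only [exchangedChains, hi₁, ↓reduceIte] at hj'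
      exact (S.sub_mem_iff_left (h₁ j (by omega))).1 hj'
  · simpa [exchangedChains, hi₁, hi₂] using hmem i j (by simpa [hi₁, hi₂] using hj)

theorem exists_add_smul (h : IsJordanBasis f d (t + Pi.single i₂ 1) v) (hi : i₁ ≠ i₂)
    (hd : d i₁ = d i₂) (ht : t i₂ < t i₁) :
    ∃ E : End K V, ∀ c : K, c ≠ 0 →
      ∃ w, IsJordanBasis (f + c • E) d (t + Pi.single i₁ 1) w := by
  let E := h.basis.constr K fun x => if x.1 = i₁ ∧ (x.2 : ℕ) = 0 then v i₂ 1 else 0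
  have hE (i : ι) (j : ℕ) (hj : j < (t + Pi.single i₂ 1 : ι → ℕ) i) :
      E (v i (j + 1)) = if i = i₁ ∧ j = 0 then v i₂ 1 else 0 := by
    simpa only [h.basis_apply] using h.basis.constr_basis K _ ⟨i, j, hj⟩
  refine ⟨E, fun c hc => ⟨exchangedChains v i₁ i₂ c,
    h.isJordanChain_exchangedChains hi hd ht fun i j hj => ?_,
    h.span_exchangedChains hi ht hc, ?_⟩⟩
  · simp only [LinearMap.add_apply, LinearMap.smul_apply, hE i j hj, smul_ite, smul_zero]
  · rw [← h.sum_eq_finrank]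
    simp [Finset.sum_add_distrib]

end IsJordanBasis

end Degeneration

section AdjointOrbit

variable {n : ℕ}

theorem adjointOrbitOf_eq_iff_exists_mul_mul_inv {X Y : Matrix (Fin n) (Fin n) ℂ} :
    adjointOrbitOf X = adjointOrbitOf Y ↔ ∃ g : GL (Fin n) ℂ, g.1 * Y * g⁻¹.1 = X := by
  unfold adjointOrbitOf
  rw [Quotient.eq'']
  exact ⟨fun ⟨g, hg⟩ => ⟨ConjAct.ofConjAct g, hg⟩, fun ⟨g, hg⟩ => ⟨ConjAct.toConjAct g, hg⟩⟩

theorem adjointOrbitOf_eq_iff_exists_conj {X Y : Matrix (Fin n) (Fin n) ℂ} :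
    adjointOrbitOf X = adjointOrbitOf Y ↔
      ∃ φ : (Fin n → ℂ) ≃ₗ[ℂ] (Fin n → ℂ), φ.conj Y.toLin' = X.toLin' := by
  rw [adjointOrbitOf_eq_iff_exists_mul_mul_inv]
  constructor
  · rintro ⟨g, rfl⟩
    refine ⟨Matrix.toLin'OfInv g.inv_mul g.mul_inv, ?_⟩
    rw [Matrix.toLin'_mul, Matrix.toLin'_mul]
    rfl
  · rintro ⟨φ, hφ⟩
    let g : GL (Fin n) ℂ :=
      { val := φ.toLinearMap.toMatrix'
        inv := φ.symm.toLinearMap.toMatrix'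
        val_inv := by rw [← LinearMap.toMatrix'_comp, LinearEquiv.comp_symm, LinearMap.toMatrix'_id]
        inv_val := by
          rw [← LinearMap.toMatrix'_comp, LinearEquiv.symm_comp, LinearMap.toMatrix'_id] }
    refine ⟨g, Matrix.toLin'.injective ?_⟩
    rw [← hφ, Matrix.toLin'_mul, Matrix.toLin'_mul]
    simp only [g, Units.inv_mk, Matrix.toLin'_toMatrix']
    rfl

theorem mem_orbit_adjointOrbitOf {X : Matrix (Fin n) (Fin n) ℂ} {O : AdjointOrbit n} :
    X ∈ O.orbit ↔ adjointOrbitOf X = O :=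
  MulAction.orbitRel.Quotient.mem_orbit

namespace AdjointOrbit

theorem exists_eq_adjointOrbitOf (O : AdjointOrbit n) : ∃ X, adjointOrbitOf X = O :=
  Quotient.exists_rep O

/-- The dimension of the kernel of `(X - a) ^ k` for `X` in the orbit `O`. -/
noncomputable def nullity (O : AdjointOrbit n) (a : ℂ) (k : ℕ) : ℕ :=
  finrank ℂ (Module.End.genEigenspace (Quotient.out O).toLin' a k)

theorem nullity_adjointOrbitOf (X : Matrix (Fin n) (Fin n) ℂ) (a : ℂ) (k : ℕ) :
    (adjointOrbitOf X).nullity a k = finrank ℂ (Module.End.genEigenspace X.toLin' a k) := by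
  obtain ⟨φ, hφ⟩ := adjointOrbitOf_eq_iff_exists_conj.1
    (Quotient.out_eq' (adjointOrbitOf X) : adjointOrbitOf _ = _)
  rw [nullity, ← hφ, finrank_genEigenspace_conj]

theorem ext_nullity {O O' : AdjointOrbit n} (h : ∀ a k, O.nullity a k = O'.nullity a k) :
    O = O' := by
  obtain ⟨X, rfl⟩ := O.exists_eq_adjointOrbitOf
  obtain ⟨Y, rfl⟩ := O'.exists_eq_adjointOrbitOf
  simp only [nullity_adjointOrbitOf] at h
  exact adjointOrbitOf_eq_iff_exists_conj.2 (exists_conj_eq_iff.2 fun a k => (h a k).symm)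

theorem nullity_add_rank (X : Matrix (Fin n) (Fin n) ℂ) (a : ℂ) (k : ℕ) :
    (adjointOrbitOf X).nullity a k + ((X - a • 1) ^ k).rank = n := by
  have hpow : (X.toLin' - a • 1) ^ k = ((X - a • 1) ^ k).mulVecLin := by
    rw [← Matrix.toLin'_apply', Matrix.toLin'_pow, map_sub, map_smul, Matrix.toLin'_one,
      Module.End.one_eq_id]
  rw [nullity_adjointOrbitOf, Module.End.genEigenspace_nat, hpow, Matrix.rank, add_comm,
    LinearMap.finrank_range_add_finrank_ker, finrank_fin_fun]

/-- The orbit `O` contains a matrix with Jordan blocks of size `s i` for the eigenvalue `d i`. -/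
def HasJordanType {ι : Type*} [Fintype ι] (O : AdjointOrbit n) (d : ι → ℂ) (s : ι → ℕ) : Prop :=
  ∃ (X : Matrix (Fin n) (Fin n) ℂ) (v : ι → ℕ → Fin n → ℂ),
    adjointOrbitOf X = O ∧ IsJordanBasis X.toLin' d s v

theorem exists_hasJordanType (O : AdjointOrbit n) :
    ∃ (ι : Type) (_ : Fintype ι) (d : ι → ℂ) (s : ι → ℕ), O.HasJordanType d s := by
  obtain ⟨X, rfl⟩ := O.exists_eq_adjointOrbitOf
  obtain ⟨ι, _, d, s, v, hv⟩ := exists_isJordanBasis X.toLin'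
  exact ⟨ι, inferInstance, d, s, X, v, rfl, hv⟩

section HasJordanType

variable {ι : Type*} [Fintype ι] {d : ι → ℂ} {s : ι → ℕ}

theorem exists_hasJordanType_of_sum_eq (d : ι → ℂ) (hs : ∑ i, s i = n) :
    ∃ O : AdjointOrbit n, O.HasJordanType d s := by
  obtain ⟨f, v, hv⟩ := exists_isJordanBasis_of_sum_eq (V := Fin n → ℂ) d s
    (hs.trans (finrank_fin_fun ℂ).symm)
  exact ⟨_, f.toMatrix', v, rfl, by rwa [Matrix.toLin'_toMatrix']⟩

theorem HasJordanType.sum_eq {O : AdjointOrbit n} (h : O.HasJordanType d s) : ∑ i, s i = n := by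
  obtain ⟨X, v, rfl, hv⟩ := h
  exact hv.sum_eq_finrank.trans (finrank_fin_fun ℂ)

theorem HasJordanType.nullity_eq {O : AdjointOrbit n} (h : O.HasJordanType d s) (a : ℂ) (k : ℕ) :
    O.nullity a k = ∑ i with d i = a, min (s i) k := by
  obtain ⟨X, v, rfl, hv⟩ := h
  rw [nullity_adjointOrbitOf, hv.finrank_genEigenspace]

theorem HasJordanType.unique {O O' : AdjointOrbit n} (h : O.HasJordanType d s)
    (h' : O'.HasJordanType d s) : O = O' :=
  ext_nullity fun a k => by rw [h.nullity_eq, h'.nullity_eq]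

end HasJordanType

end AdjointOrbit

end AdjointOrbit

section Closure

variable {n : ℕ} {S : Set (Matrix (Fin n) (Fin n) ℂ)} {X : Matrix (Fin n) (Fin n) ℂ}

theorem subset_zariskiClosure (S : Set (Matrix (Fin n) (Fin n) ℂ)) : S ⊆ zariskiClosure S :=
  fun X hX _ hp => hp X hX

theorem closure_subset_zariskiClosure (S : Set (Matrix (Fin n) (Fin n) ℂ)) :
    closure S ⊆ zariskiClosure S := by
  intro X hX p hp
  have hclosed : IsClosed {Y : Matrix (Fin n) (Fin n) ℂ |
      MvPolynomial.eval (fun ij : Fin n × Fin n => Y ij.1 ij.2) p = 0} :=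
    isClosed_eq (p.continuous_eval.comp (by fun_prop)) continuous_const
  exact closure_minimal hp hclosed hX

theorem exists_rank_le_of_mem_zariskiClosure {m : Type*} [Fintype m]
    (P : Matrix m m (MvPolynomial (Fin n × Fin n) ℂ)) (hX : X ∈ zariskiClosure S) :
    ∃ Y ∈ S, (P.map (MvPolynomial.eval fun ij => X ij.1 ij.2)).rank ≤
      (P.map (MvPolynomial.eval fun ij => Y ij.1 ij.2)).rank := by
  classical
  set M := P.map (MvPolynomial.eval fun ij => X ij.1 ij.2) with hM
  obtain ⟨V, U, e, -, -, hVU⟩ := Matrix.exists_rank_normal_form M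
  let c : Matrix m m ℂ → Matrix m m (MvPolynomial (Fin n × Fin n) ℂ) := (·.map MvPolynomial.C)
  let i : Fin M.rank → m := fun i => e.symm (Sum.inl i)
  let minor := ((c V * P * c U).submatrix i i).det
  have heval (Y : Matrix (Fin n) (Fin n) ℂ) : MvPolynomial.eval (fun ij => Y ij.1 ij.2) minor =
      ((V * P.map (MvPolynomial.eval fun ij => Y ij.1 ij.2) * U).submatrix i i).det := by
    have hmap : (c V * P * c U).map (MvPolynomial.eval fun ij => Y ij.1 ij.2) =
        V * P.map (MvPolynomial.eval fun ij => Y ij.1 ij.2) * U := by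
      simp only [c, Matrix.map_mul, Matrix.map_map, Function.comp_def, MvPolynomial.eval_C,
        Matrix.map_id']
    rw [RingHom.map_det, ← hmap]
    rfl
  have hminor : MvPolynomial.eval (fun ij => X ij.1 ij.2) minor = 1 := by
    rw [heval, ← hM, hVU, ← Matrix.det_one (n := Fin M.rank)]
    congr 1
    ext j k
    simp [i]
  obtain ⟨Y, hY, hne⟩ : ∃ Y ∈ S, MvPolynomial.eval (fun ij => Y ij.1 ij.2) minor ≠ 0 := by
    by_contra! h
    exact one_ne_zero (hminor.symm.trans (hX minor h))
  rw [heval] at hne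
  refine ⟨Y, hY, (Fintype.card_fin _).symm.trans_le ?_⟩
  rw [← Matrix.rank_of_det_ne_zero hne]
  exact (Matrix.rank_submatrix_le _ _ _).trans
    ((Matrix.rank_mul_le_left _ _).trans (Matrix.rank_mul_le_right _ _))

namespace AdjointOrbit.ClosureLE

theorem refl (O : AdjointOrbit n) : O.ClosureLE O :=
  subset_zariskiClosure _

theorem trans {O₁ O₂ O₃ : AdjointOrbit n} (h : O₁.ClosureLE O₂) (h' : O₂.ClosureLE O₃) :
    O₁.ClosureLE O₃ :=
  fun _ hX p hp => h hX p fun _ hY => h' hY p hp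

theorem nullity_le {O O' : AdjointOrbit n} (h : O.ClosureLE O') (a : ℂ) (k : ℕ) :
    O'.nullity a k ≤ O.nullity a k := by
  obtain ⟨X, rfl⟩ := O.exists_eq_adjointOrbitOf
  let P := (Matrix.mvPolynomialX (Fin n) (Fin n) ℂ -
    (MvPolynomial.C a : MvPolynomial (Fin n × Fin n) ℂ) • 1) ^ k
  have hP (Y : Matrix (Fin n) (Fin n) ℂ) :
      P.map (MvPolynomial.eval fun ij => Y ij.1 ij.2) = (Y - a • 1) ^ k := by
    rw [← RingHom.mapMatrix_apply, map_pow, map_sub, Matrix.mvPolynomialX_mapMatrix_eval]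
    congr 2
    ext i j
    by_cases hij : i = j <;> simp [hij]
  obtain ⟨Y, hY, hrank⟩ := exists_rank_le_of_mem_zariskiClosure P
    (h (mem_orbit_adjointOrbitOf.2 rfl))
  rw [hP, hP] at hrank
  rw [← mem_orbit_adjointOrbitOf.1 hY]
  have hX := nullity_add_rank X a k
  have hY := nullity_add_rank Y a k
  omega

theorem of_forall_ne_zero {X E : Matrix (Fin n) (Fin n) ℂ} {O : AdjointOrbit n}
    (h : ∀ c : ℂ, c ≠ 0 → adjointOrbitOf (X + c • E) = O) : (adjointOrbitOf X).ClosureLE O := by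
  intro Z hZ
  obtain ⟨g, rfl⟩ := adjointOrbitOf_eq_iff_exists_mul_mul_inv.1 (mem_orbit_adjointOrbitOf.1 hZ)
  apply closure_subset_zariskiClosure
  let γ : ℂ → Matrix (Fin n) (Fin n) ℂ := fun c => g.1 * (X + c • E) * g⁻¹.1
  have hγ : Continuous γ := by fun_prop
  have hmaps : Set.MapsTo γ {0}ᶜ O.orbit := fun c hc => by
    rw [mem_orbit_adjointOrbitOf, ← h c hc]
    exact adjointOrbitOf_eq_iff_exists_mul_mul_inv.2 ⟨g, rfl⟩
  have h0 := hmaps.closure hγ (dense_compl_singleton (0 : ℂ) 0)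
  simpa [γ] using h0

end AdjointOrbit.ClosureLE

theorem AdjointOrbit.HasJordanType.exists_closureLE {ι : Type*} [Fintype ι] [DecidableEq ι]
    {O : AdjointOrbit n} {d : ι → ℂ} {t : ι → ℕ} {i₁ i₂ : ι}
    (h : O.HasJordanType d (t + Pi.single i₁ 1)) (hd : d i₁ = d i₂) (ht : t i₂ < t i₁) :
    ∃ O' : AdjointOrbit n, O'.HasJordanType d (t + Pi.single i₂ 1) ∧ O'.ClosureLE O := by
  have hsum : ∑ i, (t + Pi.single i₂ 1 : ι → ℕ) i = n := by
    rw [← h.sum_eq]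
    simp only [Pi.add_apply, Finset.sum_add_distrib, Finset.sum_pi_single', Finset.mem_univ,
      if_true]
  obtain ⟨O', hO'⟩ := exists_hasJordanType_of_sum_eq d hsum
  refine ⟨O', hO', ?_⟩
  obtain ⟨X, v, rfl, hv⟩ := hO'
  obtain ⟨E, hE⟩ := hv.exists_add_smul (ne_of_apply_ne t ht.ne') hd ht
  refine ClosureLE.of_forall_ne_zero (E := E.toMatrix') fun c hc => ?_
  obtain ⟨w, hw⟩ := hE c hc
  exact HasJordanType.unique ⟨_, w, rfl, by rwa [map_add, map_smul, Matrix.toLin'_toMatrix']⟩ h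

end Closure

section Rank

theorem rank_le_card_add_card {m l K : Type*} [Finite m] [Fintype l] [Field K]
    {A : Matrix m l K} (s : Finset m) (t : Finset l)
    (h : ∀ i ∉ s, ∀ j ∉ t, A i j = 0) : A.rank ≤ s.card + t.card := by
  classical
  have := Fintype.ofFinite m
  let B : Matrix m l K := Matrix.of fun i j => if i ∈ s then A i j else 0
  let C : Matrix m l K := Matrix.of fun i j => if i ∈ s then 0 else A i j
  have hB : B.rank ≤ s.card := by
    refine B.rank_le_card_of_support_subset s (Function.support_subset_iff'.2 fun i hi => ?_)
    ext j
    exact if_neg hi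
  have hC : C.rank ≤ t.card := by
    rw [← Matrix.rank_transpose]
    refine C.transpose.rank_le_card_of_support_subset t
      (Function.support_subset_iff'.2 fun j hj => ?_)
    ext i
    by_cases hi : i ∈ s
    · exact if_pos hi
    · exact (if_neg hi).trans (h i hi j hj)
  have hBC : A = B + C := by
    ext i j
    by_cases hi : i ∈ s <;> simp [B, C, hi]
  calc A.rank ≤ finrank K ↥(B.mulVecLin.range ⊔ C.mulVecLin.range) := by
        rw [hBC, Matrix.rank, Matrix.mulVecLin_add]
        exact Submodule.finrank_mono (LinearMap.range_add_le _ _)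
    _ ≤ B.rank + C.rank := Submodule.finrank_add_le_finrank_add_finrank _ _
    _ ≤ s.card + t.card := add_le_add hB hC

end Rank

section Subdiagonal

variable {n r r' : ℕ} {X Y : Matrix (Fin n) (Fin n) ℂ}

theorem mul_mem_subdiagonalSet (hX : X ∈ subdiagonalSet n r) (hY : Y ∈ subdiagonalSet n r') :
    X * Y ∈ subdiagonalSet n (r + r') := by
  intro i j
  rw [Matrix.mul_apply]
  have hzero (l : Fin n) : (j : ℕ) + r' < l ∨ (l : ℕ) + r < i → X i l * Y l j = 0 := by
    rintro (h | h)
    · rw [(hY l j).1 h, mul_zero]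
    · rw [(hX i l).1 h, zero_mul]
  constructor
  · intro h
    exact Finset.sum_eq_zero fun l _ => hzero l (by omega)
  · intro h
    rw [Finset.sum_eq_single ⟨j + r', by omega⟩]
    · exact mul_ne_zero ((hX _ _).2 (by simp only; omega)) ((hY _ _).2 rfl)
    · intro l _ hl
      have : (l : ℕ) ≠ j + r' := fun h => hl (Fin.ext h)
      exact hzero l (by omega)
    · exact fun h => absurd (Finset.mem_univ _) h

theorem one_mem_subdiagonalSet : (1 : Matrix (Fin n) (Fin n) ℂ) ∈ subdiagonalSet n 0 := by
  intro i j
  constructor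
  · intro h
    exact Matrix.one_apply_ne (by rintro rfl; omega)
  · intro h
    obtain rfl : i = j := Fin.ext h
    simp

theorem pow_mem_subdiagonalSet (hX : X ∈ subdiagonalSet n r) (k : ℕ) :
    X ^ k ∈ subdiagonalSet n (r * k) := by
  induction k with
  | zero => exact one_mem_subdiagonalSet
  | succ k ih => exact mul_mem_subdiagonalSet ih hX

theorem sub_smul_one_mem_subdiagonalSet (hr : 0 < r) (hX : X ∈ subdiagonalSet n r) (a : ℂ) :
    X - a • 1 ∈ subdiagonalSet n r := by
  intro i j
  have happly (h : (j : ℕ) + r ≤ i) : (X - a • 1) i j = X i j := by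
    have : i ≠ j := by rintro rfl; omega
    simp [this]
  exact ⟨fun h => (happly h.le).trans ((hX i j).1 h), fun h =>
    (happly h.ge).trans_ne ((hX i j).2 h)⟩

theorem le_rank_of_mem_subdiagonalSet (hX : X ∈ subdiagonalSet n r) : n - r ≤ X.rank := by
  let B := X.submatrix (fun i : Fin (n - r) => (⟨i + r, by omega⟩ : Fin n))
    fun i : Fin (n - r) => ⟨i, by omega⟩
  have hB : B.det ≠ 0 := by
    have htri : B.IsUpperTriangular := fun i j hij => (hX _ _).1 (Nat.add_lt_add_right hij r)
    rw [Matrix.det_of_isUpperTriangular htri]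
    exact Finset.prod_ne_zero_iff.2 fun i _ => (hX _ _).2 rfl
  calc n - r = B.rank := by rw [Matrix.rank_of_det_ne_zero hB, Fintype.card_fin]
    _ ≤ X.rank := X.rank_submatrix_le _ _

theorem nullity_le_of_mem_orbitsMeeting (hr : 0 < r) {O : AdjointOrbit n}
    (hO : O ∈ orbitsMeeting n r) (a : ℂ) (k : ℕ) : O.nullity a k ≤ r * k := by
  obtain ⟨X, hXO, hX⟩ := hO
  rw [← mem_orbit_adjointOrbitOf.1 hXO]
  have hrank := le_rank_of_mem_subdiagonalSet
    (pow_mem_subdiagonalSet (sub_smul_one_mem_subdiagonalSet hr hX a) k)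
  have hadd := AdjointOrbit.nullity_add_rank X a k
  omega

end Subdiagonal

section Bidiagonal

variable {n r : ℕ} {d : Fin n → ℂ}

/-- The matrix with diagonal `d` and with ones on the `r`-th subdiagonal. -/
def bidiagonalMatrix (r : ℕ) (d : Fin n → ℂ) : Matrix (Fin n) (Fin n) ℂ :=
  Matrix.of fun i j => if i = j then d j else if (i : ℕ) = j + r then 1 else 0

theorem bidiagonalMatrix_mem_subdiagonalSet (hr : 0 < r) (d : Fin n → ℂ) :
    bidiagonalMatrix r d ∈ subdiagonalSet n r := by
  intro i j
  constructor
  · intro h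
    rw [bidiagonalMatrix, Matrix.of_apply, if_neg (by rintro rfl; omega), if_neg (by omega)]
  · intro h
    rw [bidiagonalMatrix, Matrix.of_apply, if_neg (by rintro rfl; omega), if_pos h]
    exact one_ne_zero

theorem bidiagonalMatrix_sub_pow_apply_eq_zero {a : ℂ} {s m : ℕ}
    (hd : ∀ j : Fin n, s ≤ j → (j : ℕ) < s + m → d j = a) (k : ℕ) {i j : Fin n}
    (hi : (i : ℕ) < s + min m (r * k)) (hj : s ≤ j) :
    ((bidiagonalMatrix r d - a • 1) ^ k) i j = 0 := by
  induction k generalizing i with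
  | zero =>
    rw [pow_zero, Matrix.one_apply_ne]
    rintro rfl
    omega
  | succ k ih =>
    rw [pow_succ', Matrix.mul_apply]
    refine Finset.sum_eq_zero fun l _ => ?_
    by_cases hl : (l : ℕ) < s + min m (r * k)
    · rw [ih hl, mul_zero]
    · rw [Nat.mul_succ] at hi
      refine mul_eq_zero_of_left ?_ _
      by_cases hil : i = l
      · subst hil
        simp [bidiagonalMatrix, hd i (by omega) (by omega)]
      · have : (i : ℕ) ≠ l + r := by omega
        simp [bidiagonalMatrix, hil, this]

theorem min_le_nullity_bidiagonalMatrix {a : ℂ} {s m : ℕ} (hsm : s + m ≤ n)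
    (hd : ∀ j : Fin n, s ≤ j → (j : ℕ) < s + m → d j = a) (k : ℕ) :
    min m (r * k) ≤ (adjointOrbitOf (bidiagonalMatrix r d)).nullity a k := by
  have hrank := rank_le_card_add_card (A := (bidiagonalMatrix r d - a • 1) ^ k)
    {i : Fin n | ¬ (i : ℕ) < s + min m (r * k)} {j : Fin n | (j : ℕ) < s} fun i hi j hj =>
      bidiagonalMatrix_sub_pow_apply_eq_zero hd k (by simpa using hi) (by simpa using hj)
  rw [Finset.filter_not, Finset.card_sdiff_of_subset (Finset.filter_subset _ _),
    Fin.card_filter_val_lt, Fin.card_filter_val_lt, Finset.card_univ, Fintype.card_fin] at hrank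
  have hadd := AdjointOrbit.nullity_add_rank (bidiagonalMatrix r d) a k
  omega

theorem exists_interval_fibers {α : Type*} [Inhabited α] (T : Finset α) (m : α → ℕ) :
    ∃ (d : ℕ → α) (s : α → ℕ), ∀ a ∈ T, s a + m a ≤ ∑ b ∈ T, m b ∧
      ∀ j, s a ≤ j → j < s a + m a → d j = a := by
  classical
  induction T using Finset.induction_on with
  | empty => exact ⟨fun _ => default, fun _ => 0, by simp⟩
  | insert a T ha ih =>
    obtain ⟨d, s, h⟩ := ih
    refine ⟨fun j => if j < ∑ b ∈ T, m b then d j else a, Function.update s a (∑ b ∈ T, m b),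
      fun b hb => ?_⟩
    rw [Finset.sum_insert ha]
    by_cases hba : b = a
    · subst hba
      rw [Function.update_self]
      exact ⟨by omega, fun j hj _ => if_neg (by omega)⟩
    · rw [Function.update_of_ne hba]
      obtain ⟨hle, hd⟩ := h b ((Finset.mem_insert.1 hb).resolve_left hba)
      exact ⟨by omega, fun j hj hj' => (if_pos (by omega)).trans (hd j hj hj')⟩

theorem exists_mem_orbitsMeeting_of_sum_eq (hr : 0 < r) (T : Finset ℂ) {m : ℂ → ℕ}
    (hm : ∑ a ∈ T, m a = n) :
    ∃ O ∈ orbitsMeeting n r, ∀ a ∈ T, ∀ k, min (m a) (r * k) ≤ O.nullity a k := by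
  obtain ⟨d, s, h⟩ := exists_interval_fibers T m
  refine ⟨_, ⟨bidiagonalMatrix r fun j => d j, mem_orbit_adjointOrbitOf.2 rfl,
    bidiagonalMatrix_mem_subdiagonalSet hr _⟩, fun a ha k => ?_⟩
  exact min_le_nullity_bidiagonalMatrix (hm ▸ (h a ha).1) (fun j => (h a ha).2 j) k

end Bidiagonal

section Krylov

variable {R : Type*} [CommRing R] {n r : ℕ}

/-- The matrix with columns `e_0, …, e_{r-1}, X e_0, …, X e_{r-1}, X² e_0, …`. When it is
invertible, expressing `X` in this basis yields a matrix in `subdiagonalSet n r`. -/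
def krylovMatrix (r : ℕ) (X : Matrix (Fin n) (Fin n) R) : Matrix (Fin n) (Fin n) R :=
  Matrix.of fun i j => (X ^ ((j : ℕ) / r)) i ⟨(j : ℕ) % r, (Nat.mod_le _ _).trans_lt j.2⟩

theorem mapMatrix_krylovMatrix {S : Type*} [CommRing S] (f : R →+* S) (r : ℕ)
    (X : Matrix (Fin n) (Fin n) R) :
    f.mapMatrix (krylovMatrix r X) = krylovMatrix r (f.mapMatrix X) := by
  ext i j
  simp only [krylovMatrix, Matrix.of_apply, ← map_pow]
  rfl

theorem det_krylovMatrix_ne_zero {X : Matrix (Fin n) (Fin n) ℂ} (hX : X ∈ subdiagonalSet n r) :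
    (krylovMatrix r X).det ≠ 0 := by
  have hpow (j : Fin n) := pow_mem_subdiagonalSet hX ((j : ℕ) / r)
  have hdiv (j : Fin n) : (j : ℕ) % r + r * (j / r) = j := Nat.mod_add_div _ _
  have htri : (krylovMatrix r X).IsUpperTriangular := fun i j hij =>
    (hpow j _ _).1 ((hdiv j).trans_lt hij)
  rw [Matrix.det_of_isUpperTriangular htri]
  exact Finset.prod_ne_zero_iff.2 fun j _ => (hpow j _ _).2 (hdiv j).symm

theorem mul_krylovMatrix_apply (hr : 0 < r) (X : Matrix (Fin n) (Fin n) R) (i j : Fin n)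
    (h : (j : ℕ) + r < n) : (X * krylovMatrix r X) i j = krylovMatrix r X i ⟨j + r, h⟩ := by
  simp only [krylovMatrix, Matrix.of_apply, Nat.add_div_right _ hr, Nat.add_mod_right, pow_succ']
  rfl

theorem mem_orbitsMeeting_of_det_krylovMatrix_ne_zero (hr : 0 < r)
    {X : Matrix (Fin n) (Fin n) ℂ} (hX : (krylovMatrix r X).det ≠ 0) :
    adjointOrbitOf X ∈ orbitsMeeting n r := by
  let g : GL (Fin n) ℂ := Matrix.GeneralLinearGroup.mkOfDetNeZero (krylovMatrix r X) hX
  have happly (i j : Fin n) (h : (j : ℕ) + r < n) :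
      (g⁻¹.1 * X * g.1) i j = (1 : Matrix (Fin n) (Fin n) ℂ) i ⟨j + r, h⟩ := by
    rw [← g.inv_mul, mul_assoc, Matrix.mul_apply, Matrix.mul_apply]
    exact Finset.sum_congr rfl fun l _ => congrArg _ (mul_krylovMatrix_apply hr X l j h)
  refine ⟨g⁻¹.1 * X * g.1, mem_orbit_adjointOrbitOf.2
    (adjointOrbitOf_eq_iff_exists_mul_mul_inv.2 ⟨g⁻¹, by rw [inv_inv]⟩), fun i j => ⟨fun h => ?_,
      fun h => ?_⟩⟩
  · rw [happly i j (by omega)]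
    exact Matrix.one_apply_ne (Fin.ne_of_gt h)
  · have hi : i = ⟨j + r, by omega⟩ := Fin.ext h
    rw [happly i j (by omega), ← hi, Matrix.one_apply_eq]
    exact one_ne_zero

theorem AdjointOrbit.ClosureLE.mem_orbitsMeeting (hr : 0 < r) {O O' : AdjointOrbit n}
    (h : O.ClosureLE O') (hO : O ∈ orbitsMeeting n r) : O' ∈ orbitsMeeting n r := by
  obtain ⟨X, hXO, hX⟩ := hO
  let p := (krylovMatrix r (Matrix.mvPolynomialX (Fin n) (Fin n) ℂ)).det
  have hp (Y : Matrix (Fin n) (Fin n) ℂ) :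
      MvPolynomial.eval (fun ij => Y ij.1 ij.2) p = (krylovMatrix r Y).det := by
    rw [RingHom.map_det, mapMatrix_krylovMatrix, Matrix.mvPolynomialX_mapMatrix_eval]
  obtain ⟨Y, hYO, hY⟩ : ∃ Y ∈ O'.orbit, (krylovMatrix r Y).det ≠ 0 := by
    by_contra! hzero
    exact det_krylovMatrix_ne_zero hX
      ((hp X).symm.trans (h hXO p fun Y hY => (hp Y).trans (hzero Y hY)))
  rw [← mem_orbit_adjointOrbitOf.1 hYO]
  exact mem_orbitsMeeting_of_det_krylovMatrix_ne_zero hr hY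

end Krylov

section Balanced

theorem sum_map_min_of_le_add_one {t : Multiset ℕ} (ht : ∀ x ∈ t, ∀ y ∈ t, x ≤ y + 1) (k : ℕ) :
    (t.map (min · k)).sum = min t.sum (t.card * k) := by
  by_cases hk : ∀ x ∈ t, x ≤ k
  · rw [Multiset.map_congr rfl fun x hx => min_eq_left (hk x hx), Multiset.map_id',
      min_eq_left (by simpa using Multiset.sum_le_card_nsmul t k hk)]
  · push Not at hk
    obtain ⟨x, hx, hkx⟩ := hk
    have hle (y : ℕ) (hy : y ∈ t) : k ≤ y := by linarith [ht x hx y hy]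
    rw [Multiset.map_congr rfl fun y hy => min_eq_right (hle y hy), Multiset.map_const',
      Multiset.sum_replicate, smul_eq_mul,
      min_eq_right (by simpa using Multiset.card_nsmul_le_sum hle)]

theorem sum_map_filter_ne_zero (t : Multiset ℕ) {g : ℕ → ℕ} (hg : g 0 = 0) :
    ((t.filter (· ≠ 0)).map g).sum = (t.map g).sum := by
  induction t using Multiset.induction_on with
  | empty => rfl
  | cons x t ih => by_cases hx : x = 0 <;> simpa [hx, hg] using ih

theorem sum_map_min_balancedPartition {r : ℕ} (hr : 0 < r) (m k : ℕ) :
    ((balancedPartition r m).parts.map (min · k)).sum = min m (r * k) := by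
  let t := Multiset.replicate (m % r) (m / r + 1) + Multiset.replicate (r - m % r) (m / r)
  have hparts : (balancedPartition r m).parts = t.filter (· ≠ 0) := rfl
  have hcard : t.card = r := by simp [t, (Nat.mod_lt m hr).le]
  have hsum : t.sum = m := by
    simpa [hparts] using (sum_map_filter_ne_zero t (g := id) rfl).symm.trans
      ((congrArg Multiset.sum (Multiset.map_id _)).trans (balancedPartition r m).parts_sum)
  rw [hparts, sum_map_filter_ne_zero t (Nat.zero_min k), sum_map_min_of_le_add_one ?_, hsum, hcard]
  intro x hx y hy
  simp only [t, Multiset.mem_add, Multiset.mem_replicate] at hx hy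
  omega

end Balanced

section JordanOrbit

variable {n r : ℕ}

theorem hasJordanType_jordanOrbit (q : MonicPoly n) (L : JordanData q.1) :
    (jordanOrbit q L).HasJordanType (fun b : JordanBlockIndex L => (b.1 : ℂ))
      fun b => partAt (L b.1) b.2 := by
  let e := Fintype.equivFinOfCardEq ((card_jordanIndex L).trans q.2.2)
  let b := (Pi.basisFun ℂ (Fin n)).reindex e.symm
  refine ⟨jordanMatrix q L, _, rfl, isJordanBasis_chainsOfFamily b fun x => ?_⟩
  have hb (y : (b : JordanBlockIndex L) × Fin (partAt (L b.1) b.2)) : b y = Pi.single (e y) 1 := by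
    simp [b]
  ext i
  obtain ⟨⟨c', i⟩, rfl⟩ := e.surjective i
  obtain ⟨c, j⟩ := x
  have hentry : jordanMatrix q L (e ⟨c', i⟩) (e ⟨c, j⟩) = Matrix.blockDiagonal'
      (fun b : JordanBlockIndex L => jordanBlock b.1.1 (partAt (L b.1) b.2)) ⟨c', i⟩ ⟨c, j⟩ := by
    simp [jordanMatrix, e]
  rw [Matrix.toLin'_apply, hb, Matrix.mulVec_single_one, Matrix.col_apply, hentry]
  obtain ⟨_ | j, hj⟩ := j
  · by_cases hc : c' = c
    · subst hc
      by_cases hi : i = ⟨0, hj⟩ <;> simp [jordanBlock, chainsOfFamily, hi]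
    · simp [hc, chainsOfFamily, Matrix.blockDiagonal'_apply]
  · have hj' : j < partAt (L c.1) c.2 := (Nat.lt_succ_self j).trans hj
    by_cases hc : c' = c
    · subst hc
      by_cases hi : (i : ℕ) = j + 1 <;>
        simp [jordanBlock, chainsOfFamily, hb, hi, hj', Pi.single_apply, Fin.ext_iff]
    · simp [hc, chainsOfFamily, hb, hj', Matrix.blockDiagonal'_apply]

theorem sum_jordanBlockIndex {q : ℂ[X]} (L : JordanData q) (a : ℂ) (g : ℕ → ℕ) :
    ∑ b : JordanBlockIndex L with (b.1 : ℂ) = a, g (partAt (L b.1) b.2) =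
      ((L a).parts.map g).sum := by
  classical
  have hpart (b : ℂ) : ∑ j, (if b = a then g (partAt (L b) j) else 0) =
      if b = a then ((L a).parts.map g).sum else 0 := by
    split_ifs with hb
    · subst hb
      conv_rhs => rw [← Multiset.sort_eq (L b).parts (· ≥ ·), Multiset.map_coe, Multiset.sum_coe,
        ← List.ofFn_get ((L b).parts.sort (· ≥ ·)), List.map_ofFn, List.sum_ofFn]
      rfl
    · exact Finset.sum_const_zero
  rw [Finset.sum_filter, Fintype.sum_sigma]
  simp only [hpart]
  rw [Finset.sum_coe_sort q.roots.toFinset fun b => if b = a then ((L a).parts.map g).sum else 0,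
    Finset.sum_ite_eq']
  refine ite_eq_left_iff.2 fun ha => ?_
  have hparts : (L a).parts = 0 := by
    have hzero : q.rootMultiplicity a = 0 := by
      rwa [← count_roots, Multiset.count_eq_zero, ← Multiset.mem_toFinset]
    refine Multiset.eq_zero_of_forall_notMem fun x hx => ((L a).parts_pos hx).not_ge ?_
    exact (Multiset.le_sum_of_mem hx).trans_eq ((L a).parts_sum.trans hzero)
  rw [hparts, Multiset.map_zero, Multiset.sum_zero]

theorem nullity_jordanOrbit (q : MonicPoly n) (L : JordanData q.1) (a : ℂ) (k : ℕ) :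
    (jordanOrbit q L).nullity a k = ((L a).parts.map (min · k)).sum := by
  rw [(hasJordanType_jordanOrbit q L).nullity_eq, sum_jordanBlockIndex L a (min · k)]

theorem nullity_jordanOrbit_one (q : MonicPoly n) (L : JordanData q.1) (a : ℂ) :
    (jordanOrbit q L).nullity a 1 = (L a).parts.card := by
  rw [nullity_jordanOrbit, Multiset.map_congr rfl fun x hx => min_eq_right ((L a).parts_pos hx),
    Multiset.map_const', Multiset.sum_replicate, smul_eq_mul, mul_one]

theorem nullity_jordanOrbit_le (q : MonicPoly n) (L : JordanData q.1) (a : ℂ) (k : ℕ) :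
    (jordanOrbit q L).nullity a k ≤ q.1.rootMultiplicity a := by
  rw [nullity_jordanOrbit]
  refine (Multiset.sum_map_le_sum _ fun x _ => min_le_left x k).trans_eq (L a).parts_sum

theorem nullity_jordanOrbit_rootMultiplicity (q : MonicPoly n) (L : JordanData q.1) (a : ℂ) :
    (jordanOrbit q L).nullity a (q.1.rootMultiplicity a) = q.1.rootMultiplicity a := by
  have hle (x : ℕ) (hx : x ∈ (L a).parts) : x ≤ q.1.rootMultiplicity a :=
    (Multiset.le_sum_of_mem hx).trans_eq (L a).parts_sum
  rw [nullity_jordanOrbit, Multiset.map_congr rfl fun x hx => min_eq_left (hle x hx),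
    Multiset.map_id', (L a).parts_sum]

theorem nullity_balancedOrbit (hr : 0 < r) (q : MonicPoly n) (a : ℂ) (k : ℕ) :
    (balancedOrbit r q).nullity a k = min (q.1.rootMultiplicity a) (r * k) := by
  rw [balancedOrbit, nullity_jordanOrbit, sum_map_min_balancedPartition hr]

theorem exists_eq_jordanOrbit (O : AdjointOrbit n) :
    ∃ (q : MonicPoly n) (L : JordanData q.1), O = jordanOrbit q L := by
  classical
  obtain ⟨ι, _, d, s, h⟩ := O.exists_hasJordanType
  let q : ℂ[X] := ∏ i, (X - C (d i)) ^ s i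
  have hmonic : q.Monic := monic_prod_of_monic _ _ fun i _ => (monic_X_sub_C (d i)).pow _
  have hdeg : q.natDegree = n := by
    rw [natDegree_prod_of_monic _ _ fun i _ => (monic_X_sub_C (d i)).pow _, ← h.sum_eq]
    simp only [natDegree_pow, natDegree_X_sub_C, mul_one]
  have hroot (a : ℂ) : ((Finset.univ.filter fun i => d i = a).val.map s).sum =
      q.rootMultiplicity a := by
    rw [← count_roots, roots_prod _ _ hmonic.ne_zero, Multiset.count_bind]
    simp only [roots_pow, roots_X_sub_C, Multiset.count_nsmul, Multiset.count_singleton,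
      mul_ite, mul_one, mul_zero, eq_comm (a := a)]
    exact Finset.sum_filter _ _
  let L : JordanData q := fun a => .ofSums _ ((Finset.univ.filter fun i => d i = a).val.map s)
    (hroot a)
  refine ⟨⟨q, hmonic, hdeg⟩, L, AdjointOrbit.ext_nullity fun a k => ?_⟩
  have hparts : (L a).parts = ((Finset.univ.filter fun i => d i = a).val.map s).filter (· ≠ 0) :=
    rfl
  rw [h.nullity_eq, nullity_jordanOrbit, hparts, sum_map_filter_ne_zero _ (Nat.zero_min k),
    Multiset.map_map]
  rfl

theorem sum_rootMultiplicity (q : MonicPoly n) :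
    ∑ a ∈ q.1.roots.toFinset, q.1.rootMultiplicity a = n := by
  classical
  simp only [← count_roots]
  rw [Multiset.toFinset_sum_count_eq, ← (IsAlgClosed.splits q.1).natDegree_eq_card_roots, q.2.2]

theorem eq_of_rootMultiplicity_le {q q' : MonicPoly n}
    (h : ∀ a, q.1.rootMultiplicity a ≤ q'.1.rootMultiplicity a) : q = q' := by
  classical
  have hroots : q.1.roots ≤ q'.1.roots := Multiset.le_iff_count.2 (by simpa using h)
  have hdvd : q.1 ∣ q'.1 :=
    (IsAlgClosed.splits q.1).dvd_of_roots_le_roots q.2.1.ne_zero hroots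
  exact Subtype.ext (eq_of_monic_of_dvd_of_natDegree_le q.2.1 q'.2.1 hdvd
    (q'.2.2.trans q.2.2.symm).le).symm

theorem eq_balancedOrbit_of_nullity_le (hr : 0 < r) (q : MonicPoly n) {O : AdjointOrbit n}
    (hlow : ∀ a k, min (q.1.rootMultiplicity a) (r * k) ≤ O.nullity a k)
    (hup : ∀ a k, O.nullity a k ≤ r * k) : O = balancedOrbit r q := by
  obtain ⟨q', L, rfl⟩ := exists_eq_jordanOrbit O
  obtain rfl : q = q' := eq_of_rootMultiplicity_le fun a =>
    calc q.1.rootMultiplicity a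
        = min (q.1.rootMultiplicity a) (r * q.1.rootMultiplicity a) :=
          (min_eq_left (Nat.le_mul_of_pos_left _ hr)).symm
      _ ≤ (jordanOrbit q' L).nullity a (q.1.rootMultiplicity a) := hlow a _
      _ ≤ q'.1.rootMultiplicity a := nullity_jordanOrbit_le q' L a _
  refine AdjointOrbit.ext_nullity fun a k => ?_
  rw [nullity_balancedOrbit hr]
  exact (le_min (nullity_jordanOrbit_le q L a k) (hup a k)).antisymm (hlow a k)

theorem balancedOrbit_mem_orbitsMeeting (hr : 0 < r) (q : MonicPoly n) :
    balancedOrbit r q ∈ orbitsMeeting n r := by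
  obtain ⟨O, hO, hlow⟩ :=
    exists_mem_orbitsMeeting_of_sum_eq hr q.1.roots.toFinset (sum_rootMultiplicity q)
  rwa [← eq_balancedOrbit_of_nullity_le hr q (fun a k => ?_)
    (nullity_le_of_mem_orbitsMeeting hr hO)]
  by_cases ha : a ∈ q.1.roots.toFinset
  · exact hlow a ha k
  · rw [rootMultiplicity_eq_zero (by simpa [q.2.1.ne_zero] using ha), Nat.zero_min]
    exact Nat.zero_le _

end JordanOrbit

section Balancing

variable {n r : ℕ} {ι κ : Type*} [Fintype ι] [Fintype κ] {d : ι → ℂ} {s : ι → ℕ}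

theorem sum_sq_add_single [DecidableEq ι] (t : ι → ℕ) (i : ι) :
    ∑ j, (t + Pi.single i 1 : ι → ℕ) j ^ 2 = ∑ j, t j ^ 2 + (2 * t i + 1) := by
  rw [← Finset.add_sum_erase _ _ (Finset.mem_univ i),
    ← Finset.add_sum_erase _ _ (Finset.mem_univ i), Finset.sum_congr rfl fun j hj => ?_]
  · simp only [Pi.add_apply, Pi.single_eq_same]
    ring
  · simp [Finset.ne_of_mem_erase hj]

namespace AdjointOrbit.HasJordanType

theorem of_comp_injective {O : AdjointOrbit n} {e : κ → ι} (he : e.Injective)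
    (hs : ∀ i ∉ Set.range e, s i = 0) (h : O.HasJordanType (d ∘ e) (s ∘ e)) :
    O.HasJordanType d s := by
  have hsum : ∑ i, s i = n :=
    (Fintype.sum_of_injective e he (s ∘ e) s hs fun _ => rfl).symm.trans h.sum_eq
  obtain ⟨O', hO'⟩ := exists_hasJordanType_of_sum_eq d hsum
  obtain ⟨X, v, hX, hv⟩ := id hO'
  rwa [h.unique ⟨X, _, hX, hv.comp_injective he hs⟩]

theorem nullity_eq_min {O : AdjointOrbit n} (h : O.HasJordanType d s)
    (hbal : ∀ i j, d i = d j → s i ≤ s j + 1) (a : ℂ) (k : ℕ) :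
    O.nullity a k = min (∑ i with d i = a, s i)
      ((Finset.univ.filter fun i => d i = a).card * k) := by
  have ht : ∀ x ∈ (Finset.univ.filter fun i => d i = a).val.map s,
      ∀ y ∈ (Finset.univ.filter fun i => d i = a).val.map s, x ≤ y + 1 := by
    simp only [Multiset.mem_map, Finset.mem_val, Finset.mem_filter_univ]
    rintro _ ⟨i, hi, rfl⟩ _ ⟨j, hj, rfl⟩
    exact hbal i j (hi.trans hj.symm)
  have hsum := sum_map_min_of_le_add_one ht k
  rw [Multiset.map_map, Multiset.card_map] at hsum
  exact (h.nullity_eq a k).trans hsum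

theorem exists_closureLE_forall_le_add_one {O : AdjointOrbit n} (h : O.HasJordanType d s) :
    ∃ (O' : AdjointOrbit n) (s' : ι → ℕ), O'.HasJordanType d s' ∧ O'.ClosureLE O ∧
      ∀ i j, d i = d j → s' i ≤ s' j + 1 := by
  classical
  induction hN : ∑ i, s i ^ 2 using Nat.strong_induction_on generalizing s O with
  | _ N ih =>
    by_cases hbal : ∀ i j, d i = d j → s i ≤ s j + 1
    · exact ⟨O, s, h, .refl O, hbal⟩
    push Not at hbal
    obtain ⟨i₁, i₂, hd, hlt⟩ := hbal
    obtain ⟨t, rfl⟩ : ∃ t, s = t + Pi.single i₁ 1 :=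
      ⟨s - Pi.single i₁ 1, (tsub_add_cancel_of_le fun i => by
        rcases eq_or_ne i i₁ with rfl | hi
        · have hpos : 1 ≤ s i := by omega
          simpa using hpos
        · simp [hi]).symm⟩
    have hi : i₂ ≠ i₁ := by rintro rfl; omega
    have ht : t i₂ < t i₁ := by simpa [hi] using hlt
    obtain ⟨O₁, hO₁, hle₁⟩ := h.exists_closureLE hd ht
    obtain ⟨O₂, s₂, hO₂, hle₂, hbal₂⟩ := ih _ (by
      rw [← hN, sum_sq_add_single, sum_sq_add_single]
      omega) hO₁ rfl
    exact ⟨O₂, s₂, hO₂, hle₂.trans hle₁, hbal₂⟩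

end AdjointOrbit.HasJordanType

theorem exists_hasJordanType_jordanOrbit_of_card_le (q : MonicPoly n) (L : JordanData q.1)
    (hL : ∀ a, (L a).parts.card ≤ r) :
    ∃ s : {a : ℂ // a ∈ q.1.roots.toFinset} × Fin r → ℕ,
      (jordanOrbit q L).HasJordanType (fun i => (i.1 : ℂ)) s := by
  have hlen (a : ℂ) : ((L a).parts.sort (· ≥ ·)).length ≤ r := by
    rw [Multiset.length_sort]
    exact hL a
  let s (i : {a : ℂ // a ∈ q.1.roots.toFinset} × Fin r) : ℕ :=
    ((L i.1).parts.sort (· ≥ ·)).getD i.2 0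
  let e (b : JordanBlockIndex L) : {a : ℂ // a ∈ q.1.roots.toFinset} × Fin r :=
    (b.1, Fin.castLE (hlen b.1) b.2)
  have he : Function.Injective e := by
    rintro ⟨a, j⟩ ⟨a', j'⟩ h
    obtain rfl : a = a' := congrArg Prod.fst h
    exact congrArg _ (Fin.castLE_injective (hlen a) (congrArg Prod.snd h))
  have hs : s ∘ e = fun b => partAt (L b.1) b.2 :=
    funext fun b => List.getD_eq_getElem _ _ b.2.2
  have hzero : ∀ i ∉ Set.range e, s i = 0 := by
    rintro ⟨a, j⟩ hj
    refine List.getD_eq_default _ _ (not_lt.1 fun h => hj ⟨⟨a, j, h⟩, rfl⟩)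
  exact ⟨s, .of_comp_injective he hzero (hs ▸ hasJordanType_jordanOrbit q L)⟩

theorem balancedOrbit_closureLE_jordanOrbit (hr : 0 < r) (q : MonicPoly n) (L : JordanData q.1)
    (hL : ∀ a, (L a).parts.card ≤ r) : (balancedOrbit r q).ClosureLE (jordanOrbit q L) := by
  obtain ⟨s₀, hs₀⟩ := exists_hasJordanType_jordanOrbit_of_card_le q L hL
  obtain ⟨O, s, hO, hle, hbal⟩ := hs₀.exists_closureLE_forall_le_add_one
  have hnull (a : ℂ) (ha : a ∈ q.1.roots.toFinset) (k : ℕ) :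
      O.nullity a k = min (∑ i with i.1.1 = a, s i) (r * k) := by
    have hfiber : (Finset.univ.filter
        fun i : {a : ℂ // a ∈ q.1.roots.toFinset} × Fin r => i.1.1 = a) =
        {⟨a, ha⟩} ×ˢ Finset.univ := by
      ext ⟨b, j⟩
      simp [Subtype.ext_iff, eq_comm]
    rw [hO.nullity_eq_min hbal, hfiber, Finset.card_product, Finset.card_singleton,
      Finset.card_univ, Fintype.card_fin, one_mul]
  have hnull_zero (a : ℂ) (ha : a ∉ q.1.roots.toFinset) (k : ℕ) : O.nullity a k = 0 := by
    rw [hO.nullity_eq]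
    exact Finset.sum_eq_zero fun i hi => (ha ((Finset.mem_filter_univ _).1 hi ▸ i.1.2)).elim
  rwa [← eq_balancedOrbit_of_nullity_le hr q (O := O) (fun a k => ?_) fun a k => ?_]
  · by_cases ha : a ∈ q.1.roots.toFinset
    · rw [hnull a ha]
      refine min_le_min_right _ ?_
      calc q.1.rootMultiplicity a
          = (jordanOrbit q L).nullity a (q.1.rootMultiplicity a) :=
            (nullity_jordanOrbit_rootMultiplicity q L a).symm
        _ ≤ O.nullity a (q.1.rootMultiplicity a) := hle.nullity_le a _
        _ ≤ ∑ i with i.1.1 = a, s i := (hnull a ha _).trans_le (min_le_left _ _)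
    · rw [rootMultiplicity_eq_zero (by simpa [q.2.1.ne_zero] using ha), Nat.zero_min]
      exact Nat.zero_le _
  · by_cases ha : a ∈ q.1.roots.toFinset
    · exact (hnull a ha k).trans_le (min_le_right _ _)
    · exact (hnull_zero a ha k).trans_le (Nat.zero_le _)

end Balancing

theorem theorem2p3 (n r : ℕ) (hr : 0 < r) :
    orbitsMeeting n r = orbitFilter n r ∧
      minimalOrbits (orbitsMeeting n r) =
        Set.range (fun q : MonicPoly n => balancedOrbit r q) := by
  have hfilter : orbitsMeeting n r = orbitFilter n r := by
    ext O
    simp only [orbitFilter, filterOfPoly, Set.mem_iUnion, Set.mem_ofPred_eq]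
    refine ⟨fun hO => ?_, ?_⟩
    · obtain ⟨q, L, rfl⟩ := exists_eq_jordanOrbit O
      refine ⟨q, L, fun a => ?_, rfl⟩
      simpa only [nullity_jordanOrbit_one, mul_one] using nullity_le_of_mem_orbitsMeeting hr hO a 1
    · rintro ⟨q, L, hL, rfl⟩
      exact (balancedOrbit_closureLE_jordanOrbit hr q L hL).mem_orbitsMeeting hr
        (balancedOrbit_mem_orbitsMeeting hr q)
  refine ⟨hfilter, Set.Subset.antisymm ?_ ?_⟩
  · rintro O ⟨hO, hmin⟩
    rw [hfilter] at hO
    obtain ⟨q, L, hL, rfl⟩ := Set.mem_iUnion.1 hO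
    exact ⟨q, hmin _ (balancedOrbit_mem_orbitsMeeting hr q)
      (balancedOrbit_closureLE_jordanOrbit hr q L hL)⟩
  · rintro _ ⟨q, rfl⟩
    refine ⟨balancedOrbit_mem_orbitsMeeting hr q, fun O hO hle => ?_⟩
    exact eq_balancedOrbit_of_nullity_le hr q
      (fun a k => nullity_balancedOrbit hr q a k ▸ hle.nullity_le a k)
      (nullity_le_of_mem_orbitsMeeting hr hO)
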